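/- Let $k$ be a field and let $R$ be a commutative unital $k$-algebra. A \emph{post-Lie-Rinehart algebra} $(R,L,[\,,],\rho,\rhd)$ consists of a Lie $R$-algebra $L$ (an $R$-module with an $R$-bilinear Lie bracket), a $k$-bilinear product $\rhd:L\times L\to L$ and an $R$-linear map $\rho:L\to\mathrm{Der}_k(R)$, written $\rho(x)(f)=x(f)$, such that for all $f\in R$ and $x,y,z\in L$ $$x\rhd[y,z]=[x\rhd y,z]+[y,x\rhd z],\qquad ([x,y]+x\rhd y-y\rhd x)\rhd z=x\rhd(y\rhd z)-y\rhd(x\rhd z),$$ $$\rho([x,y]+x\rhd y-y\rhd x)=[\rho(x),\rho(y)],\qquad (fx)\rhd y=f(x\rhd y),\qquad x\rhd(fy)=f(x\rhd y)+x(f)\,y .$$ Let $\mathscr U_R(L)=T_R(L)/(xy-yx-[x,y]\mid x,y\in L)$ be the universal enveloping algebra of the Lie $R$-algebra $L$, with $R$-linear structure maps determined as follows: $\Delta$ and $\varepsilon$ are algebra morphisms and $S$ is an algebra anti-morphism with $\Delta(x)=x\otimes_R1+1\otimes_Rx$, $\varepsilon(x)=0$, $S(x)=-x$ for $x\in L$.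 Let $\iota_R:R\to\mathscr U_R(L)$ be the canonical map; elements of $R$ and $L$ are also written for their images in $\mathscr U_R(L)$. A \emph{Hopf $R$-algebra} is an $R$-algebra $H$ (with unit map $\iota:R\to H$, of central image) which is an $R$-bialgebra with coproduct $\Delta$ and counit $\varepsilon$, together with an $R$-linear bijective algebra anti-homomorphism $S:H\to H$ such that $S\iota=\iota$, $\varepsilon S=\varepsilon$ and $S(x_1)x_2=x_1S(x_2)=\iota(\varepsilon(x))$ for all $x\in H$ (Sweedler notation over $R$). A \emph{weak post-Hopf algebroid} over $R$ is a cocommutative Hopf $R$-algebra $H$ with a $k$-bilinear product $\rhd$ on $H$ such that for all $f\in R$, $x,y,z\in H$ $$\Delta(x\rhd y)=(x_1\rhd y_1)\otimes_R(x_2\rhd y_2),\quad x\rhd1=\iota(\varepsilon(x)),\quad 1\rhd x=x,\quad \iota(\varepsilon(x\rhd y))=x\rhd\iota(\varepsilon(y)),$$ $$(fx)\rhd y=f(x\rhd y),\quad x\rhd(yz)=(x_1\rhd y)(x_2\rhd z),\quad x\rhd(y\rhd z)=\bigl(x_1(x_2\rhd y)\bigr)\rhd z,$$ where the right-hand sides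 do not depend on the representations of $\Delta(x)$ and $\Delta(y)$ as sums of pure tensors over $R$. \textbf{Theorem.} For every post-Lie-Rinehart algebra $(R,L,[\,,],\rho,\rhd)$ there is exactly one $k$-bilinear product $\rhd$ on $\mathscr U_R(L)$ such that $$f\rhd X=fX,\qquad x\rhd f=x(f),\qquad x\rhd(yX)=(x\rhd y)X+y(x\rhd X),\qquad (xX)\rhd Y=x\rhd(X\rhd Y)-(x\rhd X)\rhd Y$$ for all $f\in R$, $x,y\in L$ and $X,Y\in\mathscr U_R(L)$. It extends the post-Lie product of $L$, in the sense that the canonical map $L\to\mathscr U_R(L)$ respects $\rhd$, and $(\mathscr U_R(L),\Delta,\varepsilon,S,\iota_R,\rhd)$ is a weak post-Hopf algebroid over $R$; in particular $\mathscr U_R(L)$ is a cocommutative Hopf $R$-algebra. -/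

import Mathlib

open scoped TensorProduct

/-! ### Post-Lie-Rinehart algebras -/

/-- A post-Lie product on a Lie algebra `L` over `k`: a `k`-bilinear product `▷` (written `tri`)
with `x ▷ [y, z] = [x ▷ y, z] + [y, x ▷ z]` and
`([x, y] + x ▷ y - y ▷ x) ▷ z = x ▷ (y ▷ z) - y ▷ (x ▷ z)`. -/
structure IsPostLieProduct (k L : Type*) [CommRing k] [LieRing L] [Module k L]
    (tri : L →ₗ[k] L →ₗ[k] L) : Prop where
  tri_lie : ∀ x y z : L, tri x ⁅y, z⁆ = ⁅tri x y, z⁆ + ⁅y, tri x z⁆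
  lie_tri : ∀ x y z : L,
    tri (⁅x, y⁆ + tri x y - tri y x) z = tri x (tri y z) - tri y (tri x z)

/-- A post-Lie-Rinehart algebra structure over the commutative `k`-algebra `R` on a
Lie `R`-algebra `L` (its bracket is `R`-bilinear): a post-Lie product `tri` and an `R`-linear
anchor `L → Der_k(R)` which is a morphism of Lie algebras for the sub-adjacent bracket
`[x, y] + x ▷ y - y ▷ x`, subject to the two compatibility conditions with the `R`-module
structure. -/
structure PostLieRinehartAlgebra (k R L : Type*) [CommRing k] [CommRing R] [Algebra k R]
    [LieRing L] [LieAlgebra R L] [Module k L] [IsScalarTower k R L] where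
  tri : L →ₗ[k] L →ₗ[k] L
  anchor : L →ₗ[R] Derivation k R R
  isPostLie : IsPostLieProduct k L tri
  anchor_lie : ∀ x y : L, anchor (⁅x, y⁆ + tri x y - tri y x) = ⁅anchor x, anchor y⁆
  smul_tri : ∀ (f : R) (x y : L), tri (f • x) y = f • tri x y
  tri_smul : ∀ (f : R) (x y : L), tri x (f • y) = f • tri x y + anchor x f • y

/-! ### Hopf `R`-algebras and weak post-Hopf algebroids -/

/-- The properties which a cocommutative Hopf `R`-algebra has by definition, besides the axioms
of Mathlib's `HopfAlgebra R H`.  A Hopf `R`-algebra is a Hopf algebroid over `R` whose source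
(= target) map `R → H` is central, so that `H` is an `R`-algebra with `R`-linear structure maps
(a bialgebroid with central source map is precisely an `R`-bialgebra);
its antipode is an algebra anti-isomorphism fixing `R` and compatible with the counit. -/
structure IsCocommHopfRAlgebra (R H : Type*) [CommRing R] [Ring H] [HopfAlgebra R H] :
    Prop where
  cocomm : Coalgebra.IsCocomm R H
  antipode_algebraMap : ∀ f : R,
    HopfAlgebra.antipode R (algebraMap R H f) = algebraMap R H f
  antipode_mul : ∀ x y : H,
    HopfAlgebra.antipode R (x * y) = HopfAlgebra.antipode R y * HopfAlgebra.antipode R x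
  antipode_bijective : Function.Bijective (HopfAlgebra.antipode R : H →ₗ[R] H)
  counit_antipode : ∀ x : H,
    Coalgebra.counit (R := R) (HopfAlgebra.antipode R x) = Coalgebra.counit (R := R) x

/-- `(H, ▷)` is a weak post-Hopf algebroid over `R`, where `▷` is the `k`-bilinear product `tri`
on the cocommutative Hopf `R`-algebra `H`.  Identities in Sweedler notation are required for all
representations `Δ x = ∑ i, p.left i ⊗ p.right i` as finite sums of pure tensors over `R`. -/
structure IsWeakPostHopfAlgebroid (k R H : Type*) [CommRing k] [CommRing R] [Algebra k R]
    [Ring H] [HopfAlgebra R H] [Algebra k H] [IsScalarTower k R H]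
    (tri : H →ₗ[k] H →ₗ[k] H) : Prop extends IsCocommHopfRAlgebra R H where
  comul_tri : ∀ (x y : H) (p : Coalgebra.Repr R x ℕ) (q : Coalgebra.Repr R y ℕ),
    Coalgebra.comul (R := R) (tri x y) =
      ∑ i ∈ p.index, ∑ j ∈ q.index,
        tri (p.left i) (q.left j) ⊗ₜ[R] tri (p.right i) (q.right j)
  tri_one : ∀ x : H, tri x 1 = algebraMap R H (Coalgebra.counit x)
  one_tri : ∀ x : H, tri 1 x = x
  counit_tri : ∀ x y : H,
    algebraMap R H (Coalgebra.counit (tri x y)) = tri x (algebraMap R H (Coalgebra.counit y))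
  smul_tri : ∀ (f : R) (x y : H), tri (f • x) y = f • tri x y
  tri_mul : ∀ (x y z : H) (p : Coalgebra.Repr R x ℕ),
    tri x (y * z) = ∑ i ∈ p.index, tri (p.left i) y * tri (p.right i) z
  tri_tri : ∀ (x y z : H) (p : Coalgebra.Repr R x ℕ),
    tri x (tri y z) = ∑ i ∈ p.index, tri (p.left i * tri (p.right i) y) z

/-! ### The Hopf `R`-algebra structure on the universal enveloping algebra

For a Lie `R`-algebra `L`, the universal enveloping algebra is Mathlib's
`UniversalEnvelopingAlgebra R L`, the quotient of the tensor `R`-algebra `T_R(L)` by the relations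
`x y - y x = [x, y]`. -/

namespace UniversalEnvelopingAlgebra

section BaseRing

variable {k R L : Type*} [CommRing k] [CommRing R] [Algebra k R] [LieRing L] [LieAlgebra R L]
  [Module k L] [IsScalarTower k R L]

/-- The `k`-algebra structure, through the `R`-algebra structure. -/
noncomputable instance (priority := 50) instAlgebraBase : Algebra k (UniversalEnvelopingAlgebra R L) :=
  inferInstanceAs (Algebra k (ringCon R L).Quotient)

instance (priority := 50) instIsScalarTowerBase : IsScalarTower k R (UniversalEnvelopingAlgebra R L) :=
  inferInstanceAs (IsScalarTower k R (ringCon R L).Quotient)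

end BaseRing

section Hopf

attribute [local instance 100] LieRing.ofAssociativeRing

variable (R L : Type*) [CommRing R] [LieRing L] [LieAlgebra R L]

variable {R L} in
theorem ι_smul (c : R) (x : L) : ι R (c • x) = c • ι R x :=
  (ι R).map_smul c x

variable {R L} in
theorem algHom_ext_ι {A : Type*} [Ring A] [Algebra R A]
    {g₁ g₂ : UniversalEnvelopingAlgebra R L →ₐ[R] A} (h : ∀ x : L, g₁ (ι R x) = g₂ (ι R x)) :
    g₁ = g₂ :=
  hom_ext R (LieHom.ext h)

variable {R L} in
theorem lie_induction {P : UniversalEnvelopingAlgebra R L → Prop}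
    (halg : ∀ f : R, P (algebraMap R _ f)) (hι : ∀ x : L, P (ι R x))
    (hmul : ∀ a b, P a → P b → P (a * b)) (hadd : ∀ a b, P a → P b → P (a + b))
    (a : UniversalEnvelopingAlgebra R L) : P a := by
  let s : Subalgebra R (UniversalEnvelopingAlgebra R L) :=
    { carrier := {a | P a}
      mul_mem' := fun {a b} => hmul a b
      add_mem' := fun {a b} => hadd a b
      algebraMap_mem' := halg }
  let g : L →ₗ⁅R⁆ s :=
    { toFun := fun x => ⟨ι R x, hι x⟩
      map_add' := fun x y => Subtype.ext (by simp [-ι_apply])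
      map_smul' := fun c x => Subtype.ext ((ι R).map_smul c x)
      map_lie' := fun {x y} => Subtype.ext (by
        simp [-ι_apply, LieRing.of_associative_ring_bracket]) }
  have h : s.val.comp (lift R g) = AlgHom.id R _ := by
    apply hom_ext
    ext x
    change ((lift R g (ι R x) : s) : UniversalEnvelopingAlgebra R L) = ι R x
    rw [lift_ι_apply]
    rfl
  have h2 : ((lift R g a : s) : UniversalEnvelopingAlgebra R L) = a := DFunLike.congr_fun h a
  rw [← h2]
  exact (lift R g a).2

/-- The coproduct: the algebra morphism with `Δ x = x ⊗ 1 + 1 ⊗ x` for `x` in `L`. -/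
noncomputable def comulHom : UniversalEnvelopingAlgebra R L →ₐ[R]
    UniversalEnvelopingAlgebra R L ⊗[R] UniversalEnvelopingAlgebra R L :=
  lift R
    { toFun := fun x => ι R x ⊗ₜ[R] 1 + 1 ⊗ₜ[R] ι R x
      map_add' := fun x y => by simp only [map_add, TensorProduct.add_tmul,
        TensorProduct.tmul_add]; abel
      map_smul' := fun c x => by
        simp only [ι_smul, RingHom.id_apply, smul_add, TensorProduct.smul_tmul',
          TensorProduct.tmul_smul]
      map_lie' := fun {x y} => by
        simp only [LieHom.map_lie, LieRing.of_associative_ring_bracket, mul_add, add_mul,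
          Algebra.TensorProduct.tmul_mul_tmul, one_mul, mul_one, TensorProduct.sub_tmul,
          TensorProduct.tmul_sub]
        abel }

/-- The counit: the algebra morphism vanishing on `L`. -/
noncomputable def counitHom : UniversalEnvelopingAlgebra R L →ₐ[R] R :=
  lift R (0 : L →ₗ⁅R⁆ R)

/-- The antipode as an algebra morphism to the opposite algebra, sending `x` in `L` to `-x`. -/
noncomputable def antipodeHom : UniversalEnvelopingAlgebra R L →ₐ[R]
    (UniversalEnvelopingAlgebra R L)ᵐᵒᵖ :=
  lift R
    { toFun := fun x => MulOpposite.op (-ι R x)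
      map_add' := fun x y => by simp [-ι_apply, add_comm]
      map_smul' := fun c x => by
        simp only [ι_smul, ← smul_neg, MulOpposite.op_smul, RingHom.id_apply]
      map_lie' := fun {x y} => by
        simp [-ι_apply, LieRing.of_associative_ring_bracket, ← MulOpposite.op_mul] }

/-- The antipode: the `R`-linear anti-endomorphism with `S x = -x` for `x` in `L`. -/
noncomputable def antipodeMap :
    UniversalEnvelopingAlgebra R L →ₗ[R] UniversalEnvelopingAlgebra R L :=
  (MulOpposite.opLinearEquiv R).symm.toLinearMap ∘ₗ (antipodeHom R L).toLinearMap

@[simp] theorem comulHom_ι (x : L) :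
    comulHom R L (ι R x) = ι R x ⊗ₜ[R] 1 + 1 ⊗ₜ[R] ι R x :=
  lift_ι_apply ..

@[simp] theorem counitHom_ι (x : L) : counitHom R L (ι R x) = 0 :=
  lift_ι_apply ..

@[simp] theorem antipodeMap_ι (x : L) : antipodeMap R L (ι R x) = -ι R x :=
  congrArg MulOpposite.unop (lift_ι_apply ..)

@[simp] theorem antipodeMap_one : antipodeMap R L 1 = 1 := by
  simp [antipodeMap]

theorem antipodeMap_mul (a b : UniversalEnvelopingAlgebra R L) :
    antipodeMap R L (a * b) = antipodeMap R L b * antipodeMap R L a := by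
  simp [antipodeMap]

noncomputable instance instBialgebra : Bialgebra R (UniversalEnvelopingAlgebra R L) :=
  Bialgebra.ofAlgHom (comulHom R L) (counitHom R L)
    (by
      refine algHom_ext_ι fun x => ?_
      change (Algebra.TensorProduct.assoc R R R _ _ _)
        (Algebra.TensorProduct.map (comulHom R L) (.id R _) (comulHom R L (ι R x))) =
        Algebra.TensorProduct.map (.id R _) (comulHom R L) (comulHom R L (ι R x))
      simp [-ι_apply, TensorProduct.add_tmul, TensorProduct.tmul_add, Algebra.TensorProduct.one_def,
        add_assoc])
    (by
      refine algHom_ext_ι fun x => ?_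
      change Algebra.TensorProduct.map (counitHom R L) (.id R _) (comulHom R L (ι R x)) =
        1 ⊗ₜ[R] ι R x
      simp [-ι_apply])
    (by
      refine algHom_ext_ι fun x => ?_
      change Algebra.TensorProduct.map (.id R _) (counitHom R L) (comulHom R L (ι R x)) =
        ι R x ⊗ₜ[R] 1
      simp [-ι_apply])

noncomputable instance instHopfAlgebra : HopfAlgebra R (UniversalEnvelopingAlgebra R L) where
  antipode := antipodeMap R L
  mul_antipode_rTensor_comul := by
    have key : ∀ (a : UniversalEnvelopingAlgebra R L)
        (t : UniversalEnvelopingAlgebra R L ⊗[R] UniversalEnvelopingAlgebra R L),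
        LinearMap.mul' R _ ((antipodeMap R L).rTensor _ (comulHom R L a * t)) =
          counitHom R L a • LinearMap.mul' R _ ((antipodeMap R L).rTensor _ t) := by
      intro a
      induction a using lie_induction with
      | halg f => intro t; simp [-ι_apply, Algebra.algebraMap_eq_smul_one]
      | hι x =>
        intro t
        induction t using TensorProduct.induction_on with
        | zero => simp
        | add t s ht hs => simp only [mul_add, map_add, ht, hs, smul_add]
        | tmul u v => simp [-ι_apply, add_mul, antipodeMap_mul, mul_assoc]
      | hmul a b ha hb => intro t; rw [map_mul (comulHom R L), mul_assoc, ha, hb, map_mul (counitHom R L), mul_smul]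
      | hadd a b ha hb => intro t; simp only [map_add, add_mul, ha, hb, add_smul]
    ext a
    have := key a 1
    rw [mul_one] at this
    refine this.trans ?_
    simp only [Algebra.TensorProduct.one_def, LinearMap.rTensor_tmul, antipodeMap_one,
      LinearMap.mul'_apply, mul_one, ← Algebra.algebraMap_eq_smul_one]
    rfl
  mul_antipode_lTensor_comul := by
    have key : ∀ (a : UniversalEnvelopingAlgebra R L)
        (t : UniversalEnvelopingAlgebra R L ⊗[R] UniversalEnvelopingAlgebra R L),
        LinearMap.mul' R _ ((antipodeMap R L).lTensor _ (t * comulHom R L a)) =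
          counitHom R L a • LinearMap.mul' R _ ((antipodeMap R L).lTensor _ t) := by
      intro a
      induction a using lie_induction with
      | halg f => intro t; simp [-ι_apply, Algebra.algebraMap_eq_smul_one]
      | hι x =>
        intro t
        induction t using TensorProduct.induction_on with
        | zero => simp
        | add t s ht hs => simp only [add_mul, map_add, ht, hs, smul_add]
        | tmul u v => simp [-ι_apply, mul_add, antipodeMap_mul, mul_assoc]
      | hmul a b ha hb => intro t; rw [map_mul (comulHom R L), ← mul_assoc, hb, ha, map_mul (counitHom R L), mul_comm, mul_smul]
      | hadd a b ha hb => intro t; simp only [map_add, mul_add, ha, hb, add_smul]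
    ext a
    have := key a 1
    rw [one_mul] at this
    refine this.trans ?_
    simp only [Algebra.TensorProduct.one_def, LinearMap.lTensor_tmul, antipodeMap_one,
      LinearMap.mul'_apply, mul_one, ← Algebra.algebraMap_eq_smul_one]
    rfl

end Hopf

end UniversalEnvelopingAlgebra

/-- The recursive formulas for an extension `T` to `U_R(L)` of the product of a
post-Lie-Rinehart algebra `P`, where `f`, `x`, `y`, `X`, `Y` range over `R`, `L`, `L`, `U_R(L)`,
`U_R(L)`, and `R`, `L` are mapped to `U_R(L)` by the canonical maps. -/
structure PostLieRinehartAlgebra.IsExtension {k R L : Type*} [CommRing k] [CommRing R]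
    [Algebra k R] [LieRing L] [LieAlgebra R L] [Module k L] [IsScalarTower k R L]
    (P : PostLieRinehartAlgebra k R L)
    (T : UniversalEnvelopingAlgebra R L →ₗ[k]
      UniversalEnvelopingAlgebra R L →ₗ[k] UniversalEnvelopingAlgebra R L) : Prop where
  base_tri : ∀ (f : R) (X : UniversalEnvelopingAlgebra R L),
    T (algebraMap R _ f) X = algebraMap R _ f * X
  tri_base : ∀ (x : L) (f : R),
    T (UniversalEnvelopingAlgebra.ι R x) (algebraMap R _ f) = algebraMap R _ (P.anchor x f)
  tri_mul : ∀ (x y : L) (X : UniversalEnvelopingAlgebra R L),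
    T (UniversalEnvelopingAlgebra.ι R x) (UniversalEnvelopingAlgebra.ι R y * X) =
      UniversalEnvelopingAlgebra.ι R (P.tri x y) * X +
        UniversalEnvelopingAlgebra.ι R y * T (UniversalEnvelopingAlgebra.ι R x) X
  mul_tri : ∀ (x : L) (X Y : UniversalEnvelopingAlgebra R L),
    T (UniversalEnvelopingAlgebra.ι R x * X) Y =
      T (UniversalEnvelopingAlgebra.ι R x) (T X Y) -
        T (T (UniversalEnvelopingAlgebra.ι R x) X) Y

/-! ### Leibniz maps on algebras generated by a module -/

section Leibniz

variable {R L B : Type*} [CommRing R] [AddCommGroup L] [Module R L] [Ring B] [Algebra R B]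

/-! For `x` in `L` the operator `x ▷ -` on `U_R(L)` is forced to be the derivation `D_x` that
restricts to the anchor on `R` and to the post-Lie product on `L`. Such a derivation is the
`ε`-coefficient of an algebra morphism into dual numbers, and uniqueness makes `D` linear in `x`
over `R`. By the last two anchor and post-Lie axioms, `D` represents the sub-adjacent bracket
(`isLeibnizExtension_subLie`).

The product in the left variable must then satisfy `T (x b) = D_x ∘ T b - T (D_x b)`. This crossed
recursion determines `T`, because `D_x` does not increase word length (`eq_of_crossed_recursion`).
For existence the recursion is solved on the tensor algebra, where removing the first letter is
unambiguous; flatness of `D` and of composition with `D` makes the solution vanish on the ideal of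
the relations (`PostLieRinehartAlgebra.exists_crossed_recursion`).

The weak post-Hopf identities that are not immediate come from the same uniqueness: both sides, as
functions of the left variable, satisfy one crossed recursion with equal values on `R`. For the
identities in Sweedler notation this works because `D_x` is also a coderivation
(`IsLeibnizExtension.comul`, `eq_comp_comul`). -/

theorem LinearMap.mem_iSup_range_pow {j : L →ₗ[R] B}
    (hj : Algebra.adjoin R (Set.range j) = ⊤) (b : B) :
    b ∈ ⨆ n : ℕ, LinearMap.range j ^ n := by
  have hb : b ∈ Algebra.adjoin R (Set.range j) := hj ▸ Algebra.mem_top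
  rw [← Subalgebra.mem_toSubmodule, Algebra.adjoin_eq_span] at hb
  refine Submodule.span_le.2 ?_ hb
  intro w hw
  induction hw using Submonoid.closure_induction_left with
  | one => exact Submodule.mem_iSup_of_mem 0 (by rw [pow_zero]; exact Submodule.one_le.1 le_rfl)
  | mul_left x hx y _ hy =>
    have : (⨆ n : ℕ, LinearMap.range j ^ n) ≤
        (⨆ n : ℕ, LinearMap.range j ^ n).comap (LinearMap.mulLeft R x) := by
      refine iSup_le fun n z hz => Submodule.mem_iSup_of_mem (n + 1) ?_
      rw [pow_succ']
      exact Submodule.mul_mem_mul hx hz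
    exact this hy

/-- Left induction on an algebra generated by the image of `j`. -/
theorem LinearMap.induction_left_of_adjoin {j : L →ₗ[R] B}
    (hj : Algebra.adjoin R (Set.range j) = ⊤) {p : B → Prop}
    (base : ∀ f : R, p (algebraMap R B f)) (add : ∀ a b, p a → p b → p (a + b))
    (mul : ∀ (x : L) (b : B), p b → p (j x * b)) (b : B) : p b := by
  refine Submodule.iSup_induction _ (motive := p) (LinearMap.mem_iSup_range_pow hj b) ?_
    (by simpa using base 0) add
  intro n a ha
  induction ha using Submodule.pow_induction_on_left' with
  | algebraMap r => exact base r
  | add x y i hx hy h1 h2 => exact add _ _ h1 h2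
  | mem_mul m hm i x hx h =>
    obtain ⟨y, rfl⟩ := hm
    exact mul _ _ h

/-- `D` satisfies the Leibniz rule and extends `δ` on the base ring and `d` on the generators. -/
structure IsLeibnizExtension (j : L →ₗ[R] B) (δ : R → R) (d : L → L) (D : B →+ B) : Prop where
  base : ∀ f : R, D (algebraMap R B f) = algebraMap R B (δ f)
  gen : ∀ y : L, D (j y) = j (d y)
  mul : ∀ a b : B, D (a * b) = D a * b + a * D b

namespace IsLeibnizExtension

variable {j : L →ₗ[R] B} {δ : R → R} {d : L → L} {D : B →+ B}

theorem eq_of_adjoin (hj : Algebra.adjoin R (Set.range j) = ⊤) {D' : B →+ B}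
    (h : IsLeibnizExtension j δ d D) (h' : IsLeibnizExtension j δ d D') : D = D' := by
  ext b
  induction b using LinearMap.induction_left_of_adjoin hj with
  | base f => rw [h.base, h'.base]
  | add a b ha hb => rw [map_add, map_add, ha, hb]
  | mul x b hb => rw [h.mul, h'.mul, h.gen, h'.gen, hb]

theorem smul (h : IsLeibnizExtension j δ d D) (f : R) (b : B) :
    D (f • b) = f • D b + δ f • b := by
  rw [Algebra.smul_def, h.mul, h.base, Algebra.smul_def, Algebra.smul_def, add_comm]

/-- This makes the crossed recursions well founded: in `T (x b) = ∇_x (T b) - T (D_x b)` both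
arguments on the right are combinations of words one letter shorter than `x b`. -/
theorem mem_range_pow (h : IsLeibnizExtension j δ d D) {n : ℕ} {b : B}
    (hb : b ∈ LinearMap.range j ^ n) : D b ∈ LinearMap.range j ^ n := by
  induction hb using Submodule.pow_induction_on_left' with
  | algebraMap r => rw [h.base, pow_zero]; exact Submodule.algebraMap_mem _
  | add x y i hx hy h1 h2 => rw [map_add]; exact add_mem h1 h2
  | mem_mul m hm i x hx ih =>
    obtain ⟨y, rfl⟩ := hm
    rw [h.mul, h.gen, pow_succ']
    exact add_mem (Submodule.mul_mem_mul ⟨_, rfl⟩ hx) (Submodule.mul_mem_mul ⟨_, rfl⟩ ih)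

end IsLeibnizExtension

/-- Additive maps with `G (x b) = ∇_x (G b) - G (D_x b)` are determined by their values on the
base ring. -/
theorem eq_of_crossed_recursion {N : Type*} [AddCommGroup N] {j : L →ₗ[R] B}
    (hj : Algebra.adjoin R (Set.range j) = ⊤) {δ : L → R → R} {d : L → L → L} {D : L → B →+ B}
    (hD : ∀ x, IsLeibnizExtension j (δ x) (d x) (D x)) (nabla : L → N → N) {G G' : B →+ N}
    (h0 : ∀ f, G (algebraMap R B f) = G' (algebraMap R B f))
    (h : ∀ x b, G (j x * b) = nabla x (G b) - G (D x b))
    (h' : ∀ x b, G' (j x * b) = nabla x (G' b) - G' (D x b)) : G = G' := by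
  -- Plain left induction would give the hypothesis for `b` but not for `D x b`; induction on word
  -- length gives both.
  have key : ∀ (n : ℕ) (b : B), b ∈ LinearMap.range j ^ n → G b = G' b := by
    intro n
    induction n with
    | zero =>
      intro b hb
      rw [pow_zero] at hb
      obtain ⟨f, rfl⟩ := Submodule.mem_one.1 hb
      exact h0 f
    | succ n ih =>
      intro b hb
      rw [pow_succ'] at hb
      induction hb using Submodule.mul_induction_on' with
      | mem_mul_mem a ha b hb =>
        obtain ⟨x, rfl⟩ := ha
        rw [h, h', ih b hb, ih _ ((hD x).mem_range_pow hb)]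
      | add a _ b _ ha hb => rw [map_add, map_add, ha, hb]
  ext b
  refine Submodule.iSup_induction _ (motive := fun b => G b = G' b)
    (LinearMap.mem_iSup_range_pow hj b) key (by simp) ?_
  intro a b ha hb
  rw [map_add, map_add, ha, hb]

end Leibniz

/-! ### Dual numbers with a base ring embedded along a derivation -/

/-- The dual numbers `B[ε]` as an algebra over `R` through `f ↦ f + ε δ(f)`. -/
def TwistedDualNumber {k R : Type*} [CommRing k] [CommRing R] [Algebra k R]
    (_δ : Derivation k R R) (B : Type*) : Type _ := TrivSqZeroExt B B

namespace TwistedDualNumber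

variable {k R B : Type*} [CommRing k] [CommRing R] [Algebra k R] (δ : Derivation k R R)
  [Ring B]

instance : Ring (TwistedDualNumber δ B) := inferInstanceAs (Ring (TrivSqZeroExt B B))

/-- The element `a + ε b`. -/
def mk (a b : B) : TwistedDualNumber δ B := (a, b)

variable {δ}

/-- The constant term, as a ring morphism. -/
def fst : TwistedDualNumber δ B →+* B where
  toFun := TrivSqZeroExt.fst
  map_one' := rfl
  map_zero' := rfl
  map_add' _ _ := rfl
  map_mul' _ _ := rfl

/-- The coefficient of `ε`. -/
def snd : TwistedDualNumber δ B →+ B where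
  toFun := TrivSqZeroExt.snd
  map_zero' := rfl
  map_add' _ _ := rfl

@[ext] theorem ext {x y : TwistedDualNumber δ B} (h1 : fst x = fst y) (h2 : snd x = snd y) :
    x = y := Prod.ext h1 h2

@[simp] theorem fst_mk (a b : B) : fst (mk δ a b) = a := rfl

@[simp] theorem snd_mk (a b : B) : snd (mk δ a b) = b := rfl

theorem snd_mul (x y : TwistedDualNumber δ B) :
    snd (x * y) = snd x * fst y + fst x * snd y := by
  refine (TrivSqZeroExt.snd_mul (R := B) (M := B) x y).trans ?_
  rw [add_comm]
  rfl

@[simp] theorem snd_one : snd (1 : TwistedDualNumber δ B) = 0 := rfl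

variable [Algebra R B]

variable (B δ) in
/-- The twisted embedding of the base ring. -/
def baseHom : R →+* TwistedDualNumber δ B where
  toFun f := mk δ (algebraMap R B f) (algebraMap R B (δ f))
  map_one' := by ext <;> simp
  map_zero' := by ext <;> simp
  map_add' _ _ := by ext <;> simp
  -- Multiplicativity in the `ε`-coefficient is the Leibniz rule of `δ`.
  map_mul' f g := by
    ext
    · simp
    · simp only [snd_mul, snd_mk, fst_mk, Derivation.leibniz, smul_eq_mul, map_add, map_mul]
      rw [add_comm, (Algebra.commutes g (algebraMap R B (δ f)))]

instance : Algebra R (TwistedDualNumber δ B) :=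
  (baseHom B δ).toAlgebra' fun f x => by
    ext
    · simp [baseHom, Algebra.commutes]
    · simp only [snd_mul, baseHom, RingHom.coe_mk, MonoidHom.coe_mk, OneHom.coe_mk, snd_mk, fst_mk,
        Algebra.commutes]
      rw [add_comm]

@[simp] theorem fst_algebraMap (f : R) :
    fst (algebraMap R (TwistedDualNumber δ B) f) = algebraMap R B f := rfl

@[simp] theorem snd_algebraMap (f : R) :
    snd (algebraMap R (TwistedDualNumber δ B) f) = algebraMap R B (δ f) := rfl

theorem fst_smul (f : R) (x : TwistedDualNumber δ B) : fst (f • x) = f • fst x := by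
  rw [Algebra.smul_def, map_mul, fst_algebraMap, Algebra.smul_def]

theorem snd_smul (f : R) (x : TwistedDualNumber δ B) :
    snd (f • x) = f • snd x + δ f • fst x := by
  rw [Algebra.smul_def, snd_mul, fst_algebraMap, snd_algebraMap, Algebra.smul_def,
    Algebra.smul_def, add_comm]

/-- The `R`-linear map `y ↦ j y + ε j (d y)`. -/
def genMap {L : Type*} [AddCommGroup L] [Module R L] (j : L →ₗ[R] B) (d : L →+ L)
    (hd : ∀ (f : R) (y : L), d (f • y) = f • d y + δ f • y) :
    L →ₗ[R] TwistedDualNumber δ B where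
  toFun y := mk δ (j y) (j (d y))
  map_add' y z := by ext <;> simp
  map_smul' f y := by
    ext
    · simp [fst_smul]
    · simp [snd_smul, hd]

/-- The constant term of `F` is the identity, since it is so on generators; multiplicativity of `F`
then says exactly that its `ε`-coefficient is a derivation. -/
theorem exists_isLeibnizExtension {L : Type*} [AddCommGroup L] [Module R L] {j : L →ₗ[R] B}
    (hj : Algebra.adjoin R (Set.range j) = ⊤) {d : L →+ L}
    {hd : ∀ (f : R) (y : L), d (f • y) = f • d y + δ f • y}
    {F : B →ₐ[R] TwistedDualNumber δ B} (hF : ∀ y, F (j y) = genMap j d hd y) :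
    ∃ D : B →+ B, IsLeibnizExtension j δ d D := by
  have h1 : ∀ b, fst (F b) = b := by
    intro b
    induction b using LinearMap.induction_left_of_adjoin hj with
    | base f => rw [AlgHom.commutes, fst_algebraMap]
    | add a b ha hb => rw [map_add, map_add, ha, hb]
    | mul x b hb => rw [map_mul, map_mul, hb, hF]; rfl
  refine ⟨(snd (δ := δ)).comp F.toRingHom.toAddMonoidHom, ?_, ?_, ?_⟩
  · intro f
    change snd (F _) = _
    rw [AlgHom.commutes, snd_algebraMap]
  · intro y
    change snd (F _) = _
    rw [hF]; rfl
  · intro a b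
    change snd (F _) = snd (F _) * b + a * snd (F _)
    rw [map_mul, snd_mul, h1, h1]

end TwistedDualNumber

/-! ### Sums, multiples and commutators of Leibniz extensions -/

namespace IsLeibnizExtension

variable {R L B : Type*} [CommRing R] [AddCommGroup L] [Module R L] [Ring B] [Algebra R B]
  {j : L →ₗ[R] B}

theorem add {δ δ' : R → R} {d d' : L → L} {D D' : B →+ B} (h : IsLeibnizExtension j δ d D)
    (h' : IsLeibnizExtension j δ' d' D') : IsLeibnizExtension j (δ + δ') (d + d') (D + D') where
  base f := by simp [h.base, h'.base]
  gen y := by simp [h.gen, h'.gen]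
  mul a b := by
    simp only [AddMonoidHom.add_apply, h.mul, h'.mul, add_mul, mul_add]
    abel

theorem const_smul {δ : R → R} {d : L → L} {D : B →+ B} (h : IsLeibnizExtension j δ d D) (f : R) :
    IsLeibnizExtension j (f • δ) (f • d) (f • D) where
  base g := by simp [h.base, Algebra.smul_def]
  gen y := by simp [h.gen]
  mul a b := by simp [h.mul]

theorem lie {δ δ' : R → R} {d d' : L →+ L} {D D' : B →+ B} (h : IsLeibnizExtension j δ d D)
    (h' : IsLeibnizExtension j δ' d' D') :
    IsLeibnizExtension j (δ ∘ δ' - δ' ∘ δ) (d ∘ d' - d' ∘ d) (D.comp D' - D'.comp D) where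
  base f := by simp [h.base, h'.base]
  gen y := by simp [h.gen, h'.gen]
  mul a b := by
    simp only [AddMonoidHom.sub_apply, AddMonoidHom.comp_apply, h.mul, h'.mul, map_add, sub_mul,
      mul_sub]
    abel

/-- Leibniz extensions of an `R`-linear family of maps form an `R`-linear family. -/
theorem exists_linear {k : Type*} [CommRing k] [Algebra k R]
    (hj : Algebra.adjoin R (Set.range j) = ⊤) (anchor : L →ₗ[R] Derivation k R R)
    (d : L →ₗ[R] L →+ L) (h : ∀ x, ∃ D : B →+ B, IsLeibnizExtension j (anchor x) (d x) D) :
    ∃ D : L →ₗ[R] B →+ B, ∀ x, IsLeibnizExtension j (anchor x) (d x) (D x) := by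
  choose D hD using h
  refine ⟨{ toFun := D, map_add' := fun x y => ?_, map_smul' := fun f x => ?_ }, hD⟩
  -- The chosen extensions are unique, so linearity of the data in `x` passes to them.
  · refine (hD (x + y)).eq_of_adjoin hj ?_
    convert (hD x).add (hD y) using 1
    · ext; simp
    · ext; simp
  · refine (hD (f • x)).eq_of_adjoin hj ?_
    convert (hD x).const_smul f using 1
    · ext; simp
    · ext; simp
    · rfl

end IsLeibnizExtension

/-! ### Crossed recursions on the tensor algebra -/

namespace TensorAlgebra

variable {R L : Type*} [CommRing R] [AddCommGroup L] [Module R L]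

variable (R L) in
/-- Multiplication of generators with tensors, together with the scalars. -/
noncomputable def joinLeft : R × (L ⊗[R] TensorAlgebra R L) →ₗ[R] TensorAlgebra R L :=
  (Algebra.linearMap R _).coprod (TensorProduct.lift ((LinearMap.mul R _).comp (ι R)))

variable (R L) in
/-- The decomposition `T(L) → R ⊕ L ⊗ T(L)`. -/
noncomputable def splitLeft : TensorAlgebra R L →ₗ[R] R × (L ⊗[R] TensorAlgebra R L) :=
  -- `T(L)` acts on `R ⊕ L ⊗ T(L)`, a generator `x` sending `u` to `(0, x ⊗ joinLeft u)`; the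
  -- decomposition of a tensor is its action on `(1, 0)`.
  (LinearMap.applyₗ (1, 0)).comp (lift R (A := Module.End R (R × (L ⊗[R] TensorAlgebra R L)))
    { toFun := fun x => (LinearMap.inr R R _).comp
        ((TensorProduct.mk R L (TensorAlgebra R L) x).comp (joinLeft R L))
      map_add' := fun x y => by ext <;> simp
      map_smul' := fun f x => by ext <;> simp [TensorProduct.smul_tmul'] }).toLinearMap

theorem splitLeft_algebraMap (f : R) : splitLeft R L (algebraMap R _ f) = (f, 0) := by
  simp [splitLeft, Algebra.algebraMap_eq_smul_one]

theorem adjoin_range_ι' : Algebra.adjoin R (Set.range (ι R : L →ₗ[R] TensorAlgebra R L)) = ⊤ :=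
  adjoin_range_ι

theorem splitLeft_ι_mul_eq (x : L) (b : TensorAlgebra R L) :
    splitLeft R L (ι R x * b) = (0, x ⊗ₜ joinLeft R L (splitLeft R L b)) := by
  simp [splitLeft]

theorem joinLeft_splitLeft (b : TensorAlgebra R L) : joinLeft R L (splitLeft R L b) = b := by
  induction b using LinearMap.induction_left_of_adjoin adjoin_range_ι' with
  | base f => rw [splitLeft_algebraMap]; simp [joinLeft]
  | add a b ha hb => rw [map_add, map_add, ha, hb]
  | mul x b hb => rw [splitLeft_ι_mul_eq, hb]; simp [joinLeft]

theorem splitLeft_ι_mul (x : L) (b : TensorAlgebra R L) :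
    splitLeft R L (ι R x * b) = (0, x ⊗ₜ b) := by
  rw [splitLeft_ι_mul_eq, joinLeft_splitLeft]

section Recursion

variable {E : Type*} [AddCommGroup E] [Module R E] {δ : L → R → R} {d : L → L → L}
  {D : L →ₗ[R] TensorAlgebra R L →+ TensorAlgebra R L} {nabla : L →ₗ[R] E →+ E}

/-- One step of the construction of the solution of `T (x b) = ∇_x (T b) - T (D_x b)`. -/
theorem exists_crossed_step
    (hD : ∀ x, IsLeibnizExtension (ι R) (δ x) (d x) (D x))
    (hN : ∀ (x : L) (f : R) (e : E), nabla x (f • e) = f • nabla x e + δ x f • e)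
    (e₀ : E) (S : TensorAlgebra R L →ₗ[R] E) :
    ∃ S' : TensorAlgebra R L →ₗ[R] E, (∀ f : R, S' (algebraMap R _ f) = f • e₀) ∧
      ∀ x b, S' (ι R x * b) = nabla x (S b) - S (D x b) := by
  let g : L →ₗ[R] TensorAlgebra R L →ₗ[R] E :=
    LinearMap.mk₂ R (fun x b => nabla x (S b) - S (D x b))
      (fun x y b => by simp only [map_add, AddMonoidHom.add_apply]; abel)
      (fun f x b => by simp only [map_smul, AddMonoidHom.smul_apply, smul_sub])
      (fun x a b => by simp only [map_add]; abel)
      -- Neither term is `R`-linear in `b`, but their defects, both equal to `δ x f • S b`, cancel.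
      (fun f x b => by
        rw [map_smul, hN, (hD x).smul, map_add, map_smul, map_smul, smul_sub]; abel)
  refine ⟨((LinearMap.toSpanSingleton R E e₀).coprod (TensorProduct.lift g)).comp
    (splitLeft R L), fun f => ?_, fun x b => ?_⟩
  · simp [splitLeft_algebraMap]
  · simp [splitLeft_ι_mul, g]

/-- Solution on the tensor algebra of `T (x b) = ∇_x (T b) - T (D_x b)`. -/
theorem exists_crossed_recursion
    (hD : ∀ x, IsLeibnizExtension (ι R) (δ x) (d x) (D x))
    (hN : ∀ (x : L) (f : R) (e : E), nabla x (f • e) = f • nabla x e + δ x f • e) (e₀ : E) :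
    ∃ T : TensorAlgebra R L →ₗ[R] E, (∀ f : R, T (algebraMap R _ f) = f • e₀) ∧
      ∀ x b, T (ι R x * b) = nabla x (T b) - T (D x b) := by
  choose next next_base next_mul using exists_crossed_step hD hN e₀
  -- The exponent `n + 1` ensures that already `S 0` has the right values on `R`.
  let S : ℕ → TensorAlgebra R L →ₗ[R] E := fun n => next^[n + 1] 0
  have S_succ (n) : S (n + 1) = next (S n) := Function.iterate_succ_apply' ..
  have S_base (n f) : S n (algebraMap R _ f) = f • e₀ := by
    change next^[n + 1] 0 _ = _
    rw [Function.iterate_succ_apply', next_base]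
  -- The iterates are constant on words of length `m` from index `m` on; the solution is their
  -- eventual value.
  have stable : ∀ (m : ℕ) (b : TensorAlgebra R L), b ∈ LinearMap.range (ι R (M := L)) ^ m →
      ∀ n, m ≤ n → S (n + 1) b = S n b := by
    intro m
    induction m with
    | zero =>
      intro b hb n _
      rw [pow_zero] at hb
      obtain ⟨f, rfl⟩ := Submodule.mem_one.1 hb
      rw [S_base, S_base]
    | succ m ih =>
      intro b hb n hn
      obtain ⟨n, rfl⟩ : ∃ n', n = n' + 1 := ⟨n - 1, by omega⟩
      rw [pow_succ'] at hb
      induction hb using Submodule.mul_induction_on' with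
      | mem_mul_mem a ha b hb =>
        obtain ⟨x, rfl⟩ := ha
        rw [S_succ (n + 1), S_succ n, next_mul, next_mul, ← S_succ, ih b hb n (by omega),
          ih _ ((hD x).mem_range_pow hb) n (by omega)]
      | add a _ b _ ha hb => rw [map_add, map_add, ha, hb]
  have eventually_const : ∀ b, ∃ e, ∃ m, ∀ n, m ≤ n → S n b = e := by
    intro b
    refine Submodule.iSup_induction _ (motive := fun b => ∃ e, ∃ m, ∀ n, m ≤ n → S n b = e)
      (LinearMap.mem_iSup_range_pow adjoin_range_ι' b) ?_ ⟨0, 0, by simp⟩ ?_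
    · intro m b hb
      exact ⟨S m b, m, fun n hn => Nat.le_induction rfl (fun n hn h => (stable m b hb n hn).trans h)
        n hn⟩
    · rintro a b ⟨e, m, h⟩ ⟨e', m', h'⟩
      exact ⟨e + e', max m m', fun n hn => by
        rw [map_add, h n (le_of_max_le_left hn), h' n (le_of_max_le_right hn)]⟩
  choose T m hT using eventually_const
  have T_eq {b e} (M : ℕ) (h : ∀ n, M ≤ n → S n b = e) : T b = e :=
    (hT b (max (m b) M) (le_max_left ..)).symm.trans (h _ (le_max_right ..))
  refine ⟨{ toFun := T, map_add' := fun a b => ?_, map_smul' := fun f b => ?_ },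
    fun f => ?_, fun x b => ?_⟩
  · exact T_eq (max (m a) (m b)) fun n hn => by
      rw [map_add, hT a n (le_of_max_le_left hn), hT b n (le_of_max_le_right hn)]
  · exact T_eq (m b) fun n hn => by rw [map_smul, hT b n hn]; rfl
  · exact T_eq 0 fun n _ => S_base n f
  · refine T_eq (max (m b) (m (D x b)) + 1) fun n hn => ?_
    obtain ⟨n, rfl⟩ : ∃ n', n = n' + 1 := ⟨n - 1, by omega⟩
    rw [S_succ, next_mul, hT b n (by omega), hT (D x b) n (by omega)]
    rfl

end Recursion

end TensorAlgebra

/-! ### The derivations `D_x` on the tensor algebra and their flatness -/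

namespace PostLieRinehartAlgebra

variable {k R L : Type*} [CommRing k] [CommRing R] [Algebra k R] [LieRing L] [LieAlgebra R L]
  [Module k L] [IsScalarTower k R L] (P : PostLieRinehartAlgebra k R L)

/-- The post-Lie product as an `R`-linear family of additive maps. -/
def triHom : L →ₗ[R] L →+ L where
  toFun x := (P.tri x).toAddMonoidHom
  map_add' x y := by ext; simp
  map_smul' f x := by ext; simp [P.smul_tri]

@[simp] theorem triHom_apply (x y : L) : P.triHom x y = P.tri x y := rfl

/-- The sub-adjacent bracket `[x, y] + x ▷ y - y ▷ x`. -/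
def subLie (x y : L) : L := ⁅x, y⁆ + P.tri x y - P.tri y x

/-- A commutator of derivations is a derivation, and the two sides agree on `R` by `anchor_lie` and
on `L` by `lie_tri`. -/
theorem isLeibnizExtension_subLie {B : Type*} [Ring B] [Algebra R B] {j : L →ₗ[R] B}
    (hj : Algebra.adjoin R (Set.range j) = ⊤) {D : L →ₗ[R] B →+ B}
    (hD : ∀ x, IsLeibnizExtension j (P.anchor x) (P.triHom x) (D x)) (x y : L) (b : B) :
    D (P.subLie x y) b = D x (D y b) - D y (D x b) := by
  have h : D (P.subLie x y) = (D x).comp (D y) - (D y).comp (D x) := by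
    refine (hD _).eq_of_adjoin hj ?_
    convert (hD x).lie (hD y) using 1
    · ext f
      simp [subLie, P.anchor_lie, Derivation.commutator_apply]
    · ext z
      exact P.isPostLie.lie_tri x y z
  rw [h]
  rfl

theorem triHom_smul (x : L) (f : R) (y : L) :
    P.triHom x (f • y) = f • P.triHom x y + P.anchor x f • y := P.tri_smul f x y

theorem exists_tensor_derivations :
    ∃ D : L →ₗ[R] TensorAlgebra R L →+ TensorAlgebra R L,
      ∀ x, IsLeibnizExtension (TensorAlgebra.ι R) (P.anchor x) (P.triHom x) (D x) :=
  IsLeibnizExtension.exists_linear TensorAlgebra.adjoin_range_ι' P.anchor P.triHom fun x =>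
    TwistedDualNumber.exists_isLeibnizExtension TensorAlgebra.adjoin_range_ι'
      (hd := P.triHom_smul x) (F := TensorAlgebra.lift R (TwistedDualNumber.genMap _ _ _))
      fun y => TensorAlgebra.lift_ι_apply _ y

end PostLieRinehartAlgebra

/-! ### The enveloping algebra as a quotient of the tensor algebra -/

namespace UniversalEnvelopingAlgebra

variable {R L : Type*} [CommRing R] [LieRing L] [LieAlgebra R L]

variable (R L) in
/-- The canonical map `L → U_R(L)` as an `R`-linear map. -/
def ιLinear : L →ₗ[R] UniversalEnvelopingAlgebra R L where
  toFun := ι R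
  map_add' := map_add (ι R)
  map_smul' := ι_smul

@[simp] theorem ιLinear_apply (x : L) : ιLinear R L x = ι R x := rfl

theorem adjoin_range_ιLinear : Algebra.adjoin R (Set.range (ιLinear R L)) = ⊤ := by
  refine eq_top_iff.2 fun a _ => ?_
  induction a using lie_induction with
  | halg f => exact Subalgebra.algebraMap_mem _ f
  | hι x => exact Algebra.subset_adjoin ⟨x, rfl⟩
  | hmul a b ha hb => exact mul_mem (ha trivial) (hb trivial)
  | hadd a b ha hb => exact add_mem (ha trivial) (hb trivial)

theorem mkAlgHom_surjective : Function.Surjective (mkAlgHom R L) :=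
  RingCon.mkₐ_surjective _

theorem mkAlgHom_ι (x : L) : mkAlgHom R L (TensorAlgebra.ι R x) = ι R x := (ι_apply R x).symm

section Lie

attribute [local instance 100] LieRing.ofAssociativeRing

theorem ι_lie (x y : L) : ι R ⁅x, y⁆ = ι R x * ι R y - ι R y * ι R x :=
  ((ι R).map_lie x y).trans (LieRing.of_associative_ring_bracket _ _)

end Lie

/-- An `R`-linear map on the tensor algebra which kills the ideal generated by the elements
`x y - y x - [x, y]` factors through the universal enveloping algebra. -/
theorem exists_factor_mkAlgHom {E : Type*} [AddCommGroup E] [Module R E]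
    (T : TensorAlgebra R L →ₗ[R] E)
    (hT : ∀ a b x y, T (a * (TensorAlgebra.ι R x * TensorAlgebra.ι R y -
      TensorAlgebra.ι R y * TensorAlgebra.ι R x - TensorAlgebra.ι R ⁅x, y⁆) * b) = 0) :
    ∃ T' : UniversalEnvelopingAlgebra R L →ₗ[R] E, ∀ a, T' (mkAlgHom R L a) = T a := by
  -- The largest ring congruence whose classes lie in fibres of `T`; it contains the defining
  -- relations, hence the congruence they generate.
  let c : RingCon (TensorAlgebra R L) :=
    { r := fun a b => ∀ u v, T (u * a * v) = T (u * b * v)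
      iseqv := ⟨fun _ _ _ => rfl, fun h u v => (h u v).symm,
        fun h h' u v => (h u v).trans (h' u v)⟩
      add' := fun h h' u v => by simp only [mul_add, add_mul, map_add, h u v, h' u v]
      mul' := fun {a b a' b'} h h' u v => by
        have h1 := h u (a' * v)
        have h2 := h' (u * b) v
        simp only [mul_assoc] at h1 h2 ⊢
        rw [h1, h2] }
  have hc : ringCon R L ≤ c := by
    rw [ringCon, RingCon.ringConGen_le]
    intro a b h
    induction h with
    | lie_compat x y =>
      intro u v
      have := hT u v x y
      rw [← sub_eq_zero, ← neg_eq_zero, ← map_sub, ← map_neg, ← this]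
      congr 1
      noncomm_ring
  have hker : LinearMap.ker (mkAlgHom R L).toLinearMap ≤ LinearMap.ker T := by
    intro a ha
    have h : (mkAlgHom R L) a = (mkAlgHom R L) 0 := by rw [map_zero]; exact ha
    have h1 : c a 0 := hc ((RingCon.eq _).1 h)
    simpa using h1 1 1
  refine ⟨(LinearMap.ker (mkAlgHom R L).toLinearMap).liftQ T hker ∘ₗ
    ((mkAlgHom R L).toLinearMap.quotKerEquivOfSurjective mkAlgHom_surjective).symm.toLinearMap,
    fun a => ?_⟩
  have : ((mkAlgHom R L).toLinearMap.quotKerEquivOfSurjective mkAlgHom_surjective).symm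
      (mkAlgHom R L a) = Submodule.Quotient.mk a := by
    rw [LinearEquiv.symm_apply_eq]; rfl
  simp [this]

end UniversalEnvelopingAlgebra

/-! ### Derivations and crossed recursions on the enveloping algebra -/

namespace PostLieRinehartAlgebra

open UniversalEnvelopingAlgebra

variable {k R L : Type*} [CommRing k] [CommRing R] [Algebra k R] [LieRing L] [LieAlgebra R L]
  [Module k L] [IsScalarTower k R L] (P : PostLieRinehartAlgebra k R L)

section Lie

attribute [local instance 100] LieRing.ofAssociativeRing

/-- The map `y ↦ y + ε (x ▷ y)` extends to `U_R(L)` because it respects brackets, which in the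
`ε`-coefficient is the axiom `tri_lie`. -/
theorem exists_derivations :
    ∃ D : L →ₗ[R] UniversalEnvelopingAlgebra R L →+ UniversalEnvelopingAlgebra R L,
      ∀ x, IsLeibnizExtension (ιLinear R L) (P.anchor x) (P.triHom x) (D x) := by
  refine IsLeibnizExtension.exists_linear adjoin_range_ιLinear P.anchor P.triHom fun x => ?_
  let g := TwistedDualNumber.genMap (ιLinear R L) (P.triHom x) (P.triHom_smul x)
  have hg : ∀ y z, g ⁅y, z⁆ = g y * g z - g z * g y := by
    intro y z
    ext
    · change ι R ⁅y, z⁆ = ι R y * ι R z - ι R z * ι R y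
      exact ι_lie y z
    · rw [map_sub, TwistedDualNumber.snd_mul, TwistedDualNumber.snd_mul]
      change ι R (P.tri x ⁅y, z⁆) = ι R (P.tri x y) * ι R z + ι R y * ι R (P.tri x z) -
        (ι R (P.tri x z) * ι R y + ι R z * ι R (P.tri x y))
      rw [P.isPostLie.tri_lie, map_add, ι_lie, ι_lie]
      abel
  exact TwistedDualNumber.exists_isLeibnizExtension adjoin_range_ιLinear
    (hd := P.triHom_smul x)
    (F := lift R
      { g with
        map_lie' := fun {y z} => (hg y z).trans (LieRing.of_associative_ring_bracket _ _).symm })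
    fun y => lift_ι_apply ..

end Lie

/-- Solution on `U_R(L)` of `T (x b) = ∇_x (T b) - T (D_x b)`, for a flat connection `∇` of the
sub-adjacent Lie-Rinehart algebra. -/
theorem exists_crossed_recursion {E : Type*} [AddCommGroup E] [Module R E]
    {D : L →ₗ[R] UniversalEnvelopingAlgebra R L →+ UniversalEnvelopingAlgebra R L}
    (hD : ∀ x, IsLeibnizExtension (ιLinear R L) (P.anchor x) (P.triHom x) (D x))
    {nabla : L →ₗ[R] E →+ E}
    (hN : ∀ (x : L) (f : R) (e : E), nabla x (f • e) = f • nabla x e + P.anchor x f • e)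
    (flat : ∀ x y e, nabla (P.subLie x y) e = nabla x (nabla y e) - nabla y (nabla x e))
    (e₀ : E) :
    ∃ T : UniversalEnvelopingAlgebra R L →ₗ[R] E, (∀ f : R, T (algebraMap R _ f) = f • e₀) ∧
      ∀ x b, T (ι R x * b) = nabla x (T b) - T (D x b) := by
  obtain ⟨DT, hDT⟩ := P.exists_tensor_derivations
  obtain ⟨T, hT_base, hT⟩ := TensorAlgebra.exists_crossed_recursion hDT hN e₀
  have compat : ∀ x a, mkAlgHom R L (DT x a) = D x (mkAlgHom R L a) := by
    intro x a
    induction a using LinearMap.induction_left_of_adjoin TensorAlgebra.adjoin_range_ι' with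
    | base f => rw [(hDT x).base, AlgHom.commutes, AlgHom.commutes, (hD x).base]
    | add a b ha hb => simp only [map_add, ha, hb]
    | mul y b hb =>
      rw [(hDT x).mul, map_mul, map_add, map_mul, map_mul, (hD x).mul, (hDT x).gen, hb, mkAlgHom_ι,
        mkAlgHom_ι, ← ιLinear_apply y, (hD x).gen]
      rfl
  let r (y z : L) : TensorAlgebra R L := TensorAlgebra.ι R y * TensorAlgebra.ι R z -
      TensorAlgebra.ι R z * TensorAlgebra.ι R y - TensorAlgebra.ι R ⁅y, z⁆
  have D_r (x y z) : DT x (r y z) = r (P.tri x y) z + r y (P.tri x z) := by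
    simp only [r, map_sub, (hDT x).mul, (hDT x).gen, triHom_apply, P.isPostLie.tri_lie, map_add]
    abel
  -- With `[y, z]` rewritten through the sub-adjacent bracket, two rounds of the recursion leave
  -- only terms that cancel by flatness of `nabla` and of `DT`.
  have T_r_mul (y z b) : T (r y z * b) = 0 := by
    have e : ⁅y, z⁆ = P.subLie y z - P.tri y z + P.tri z y := by
      simp only [subLie]; abel
    simp only [r, e, sub_mul, add_mul, mul_assoc, map_sub, map_add, hT, (hDT _).mul, (hDT _).gen,
      flat, P.isLeibnizExtension_subLie TensorAlgebra.adjoin_range_ι' hDT, triHom_apply]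
    abel
  -- Induction on the length of the left factor. By `D_r`, applying `DT x` to `a * r y z * b` gives
  -- terms of the same shape with left factor no longer than `a`, so `y`, `z`, `b` stay quantified.
  have T_mul_r_mul : ∀ (n : ℕ) (a : TensorAlgebra R L),
      a ∈ LinearMap.range (TensorAlgebra.ι R (M := L)) ^ n →
      ∀ y z b, T (a * r y z * b) = 0 := by
    intro n
    induction n with
    | zero =>
      intro a ha y z b
      rw [pow_zero] at ha
      obtain ⟨f, rfl⟩ := Submodule.mem_one.1 ha
      rw [mul_assoc, ← Algebra.smul_def, map_smul, T_r_mul, smul_zero]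
    | succ n ih =>
      intro a ha y z b
      rw [pow_succ'] at ha
      induction ha using Submodule.mul_induction_on' with
      | mem_mul_mem c hc a ha =>
        obtain ⟨x, rfl⟩ := hc
        rw [mul_assoc, mul_assoc, hT, ← mul_assoc, ih a ha, (hDT x).mul, (hDT x).mul, D_r, mul_add,
          add_mul, add_mul, map_add, map_add, map_add, ih _ ((hDT x).mem_range_pow ha), ih a ha,
          ih a ha, ih a ha]
        simp
      | add a _ c _ ha hc => rw [add_mul, add_mul, map_add, ha, hc, add_zero]
  obtain ⟨T', hT'⟩ := exists_factor_mkAlgHom T fun a b y z =>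
    Submodule.iSup_induction _ (motive := fun a => T (a * r y z * b) = 0)
      (LinearMap.mem_iSup_range_pow TensorAlgebra.adjoin_range_ι' a)
      (fun n a ha => T_mul_r_mul n a ha y z b) (by simp)
      fun a c ha hc => by rw [add_mul, add_mul, map_add, ha, hc, add_zero]
  refine ⟨T', fun f => ?_, fun x b => ?_⟩
  · rw [← AlgHom.commutes (mkAlgHom R L), hT', hT_base]
  · obtain ⟨b, rfl⟩ := mkAlgHom_surjective b
    rw [← mkAlgHom_ι, ← map_mul, hT', hT, hT', ← compat, hT']

end PostLieRinehartAlgebra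

/-! ### The cocommutative Hopf algebra axioms -/

namespace UniversalEnvelopingAlgebra

variable (R L : Type*) [CommRing R] [LieRing L] [LieAlgebra R L]

variable {R L} in
theorem comul_ι (x : L) : Coalgebra.comul (R := R) (ι R x) = ι R x ⊗ₜ[R] 1 + 1 ⊗ₜ[R] ι R x :=
  comulHom_ι R L x

variable {R L} in
theorem counit_ι (x : L) : Coalgebra.counit (R := R) (ι R x) = 0 :=
  counitHom_ι R L x

theorem antipodeMap_algebraMap (f : R) : antipodeMap R L (algebraMap R _ f) = algebraMap R _ f := by
  simp [antipodeMap]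

theorem antipodeMap_antipodeMap (a : UniversalEnvelopingAlgebra R L) :
    antipodeMap R L (antipodeMap R L a) = a := by
  induction a using lie_induction with
  | halg f => rw [antipodeMap_algebraMap, antipodeMap_algebraMap]
  | hι x => rw [antipodeMap_ι, map_neg, antipodeMap_ι, neg_neg]
  | hmul a b ha hb => rw [antipodeMap_mul, antipodeMap_mul, ha, hb]
  | hadd a b ha hb => rw [map_add, map_add, ha, hb]

theorem counitHom_antipodeMap (a : UniversalEnvelopingAlgebra R L) :
    counitHom R L (antipodeMap R L a) = counitHom R L a := by
  induction a using lie_induction with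
  | halg f => rw [antipodeMap_algebraMap]
  | hι x => rw [antipodeMap_ι, map_neg, counitHom_ι, neg_zero]
  | hmul a b ha hb => rw [antipodeMap_mul, map_mul, map_mul, ha, hb, mul_comm]
  | hadd a b ha hb => rw [map_add, map_add, map_add, ha, hb]

theorem isCocomm : Coalgebra.IsCocomm R (UniversalEnvelopingAlgebra R L) where
  comm_comp_comul := by
    have h : (Algebra.TensorProduct.comm R _ _).toAlgHom.comp (comulHom R L) = comulHom R L := by
      refine algHom_ext_ι fun x => ?_
      change Algebra.TensorProduct.comm R _ _ (comulHom R L (ι R x)) = _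
      rw [comulHom_ι, map_add, Algebra.TensorProduct.comm_tmul, Algebra.TensorProduct.comm_tmul,
        add_comm]
    exact LinearMap.ext fun a => DFunLike.congr_fun h a

theorem isCocommHopfRAlgebra : IsCocommHopfRAlgebra R (UniversalEnvelopingAlgebra R L) where
  cocomm := isCocomm R L
  antipode_algebraMap := antipodeMap_algebraMap R L
  antipode_mul := antipodeMap_mul R L
  antipode_bijective :=
    Function.Involutive.bijective (f := antipodeMap R L) (antipodeMap_antipodeMap R L)
  counit_antipode := counitHom_antipodeMap R L

end UniversalEnvelopingAlgebra

open UniversalEnvelopingAlgebra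

/-! ### Compatibility of the derivations with coproduct and counit -/

namespace IsLeibnizExtension

variable {R L : Type*} [CommRing R] [LieRing L] [LieAlgebra R L] {δ : R → R} {d : L → L}
  {D : UniversalEnvelopingAlgebra R L →+ UniversalEnvelopingAlgebra R L}

/-- The additive map `D ⊗ 1 + 1 ⊗ D` on `U_R(L) ⊗_R U_R(L)`. -/
noncomputable def tensor (h : IsLeibnizExtension (ιLinear R L) δ d D) :
    UniversalEnvelopingAlgebra R L ⊗[R] UniversalEnvelopingAlgebra R L →+
      UniversalEnvelopingAlgebra R L ⊗[R] UniversalEnvelopingAlgebra R L :=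
  TensorProduct.liftAddHom
    (AddMonoidHom.mk' (fun a => AddMonoidHom.mk' (fun b => D a ⊗ₜ[R] b + a ⊗ₜ[R] D b)
      (fun b c => by simp only [map_add, TensorProduct.tmul_add]; abel))
      (fun a b => by
        ext c
        simp only [AddMonoidHom.mk'_apply, AddMonoidHom.add_apply, map_add, TensorProduct.add_tmul]
        abel))
    -- `D ⊗ 1` and `1 ⊗ D` are not separately balanced over `R`; in their sum the extra term `δ f •
    -- (a ⊗ b)` appears whichever factor carries `f`.
    (fun f a b => by
      simp only [AddMonoidHom.mk'_apply, h.smul, TensorProduct.add_tmul, TensorProduct.tmul_add,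
        TensorProduct.tmul_smul, TensorProduct.smul_tmul']
      abel)

variable (h : IsLeibnizExtension (ιLinear R L) δ d D)

@[simp] theorem tensor_tmul (a b : UniversalEnvelopingAlgebra R L) :
    h.tensor (a ⊗ₜ[R] b) = D a ⊗ₜ[R] b + a ⊗ₜ[R] D b := rfl

theorem tensor_mul (s t : UniversalEnvelopingAlgebra R L ⊗[R] UniversalEnvelopingAlgebra R L) :
    h.tensor (s * t) = h.tensor s * t + s * h.tensor t := by
  induction s using TensorProduct.induction_on with
  | zero => simp
  | add s s' hs hs' => simp only [add_mul, map_add, hs, hs']; abel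
  | tmul a b =>
    induction t using TensorProduct.induction_on with
    | zero => simp
    | add t t' ht ht' => simp only [mul_add, map_add, ht, ht']; abel
    | tmul a' b' =>
      simp only [Algebra.TensorProduct.tmul_mul_tmul, tensor_tmul, h.mul, TensorProduct.add_tmul,
        TensorProduct.tmul_add, add_mul, mul_add]
      abel

include h in
theorem map_one : D 1 = 0 := by
  simpa using h.mul 1 1

/-- `D` is a coderivation: both sides obey a Leibniz rule along `Δ`, and they agree on generators
because `D` maps the primitive element `y` to the primitive element `d y`. -/
theorem comul (a : UniversalEnvelopingAlgebra R L) :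
    Coalgebra.comul (R := R) (D a) = h.tensor (Coalgebra.comul (R := R) a) := by
  induction a using LinearMap.induction_left_of_adjoin adjoin_range_ιLinear with
  | base f =>
    rw [h.base, Bialgebra.comul_algebraMap, Bialgebra.comul_algebraMap,
      Algebra.TensorProduct.algebraMap_apply, Algebra.TensorProduct.algebraMap_apply, tensor_tmul,
      h.base, h.map_one, TensorProduct.tmul_zero, add_zero]
  | add a b ha hb => simp only [map_add, ha, hb]
  | mul x b hb =>
    rw [h.mul, map_add, Bialgebra.comul_mul, Bialgebra.comul_mul, Bialgebra.comul_mul, tensor_mul,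
      hb, h.gen, ιLinear_apply, ιLinear_apply, comul_ι, comul_ι]
    simp [-ι_apply, ← ιLinear_apply, h.gen, h.map_one]

include h in
theorem counit (h0 : δ 0 = 0) (hadd : ∀ f g, δ (f + g) = δ f + δ g)
    (a : UniversalEnvelopingAlgebra R L) :
    Coalgebra.counit (R := R) (D a) = δ (Coalgebra.counit (R := R) a) := by
  induction a using LinearMap.induction_left_of_adjoin adjoin_range_ιLinear with
  | base f => rw [h.base, Bialgebra.counit_algebraMap, Bialgebra.counit_algebraMap]
  | add a b ha hb => simp only [map_add, ha, hb, hadd]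
  | mul x b hb =>
    rw [h.mul, map_add, Bialgebra.counit_mul, Bialgebra.counit_mul, Bialgebra.counit_mul, h.gen]
    simp [-ι_apply, counit_ι, h0]

end IsLeibnizExtension

/-! ### Construction of the product -/

namespace PostLieRinehartAlgebra

variable {k R L : Type*} [CommRing k] [CommRing R] [Algebra k R] [LieRing L] [LieAlgebra R L]
  [Module k L] [IsScalarTower k R L] (P : PostLieRinehartAlgebra k R L)
  {D : L →ₗ[R] UniversalEnvelopingAlgebra R L →+ UniversalEnvelopingAlgebra R L}

theorem derivation_smul_base
    (hD : ∀ x, IsLeibnizExtension (ιLinear R L) (P.anchor x) (P.triHom x) (D x)) (x : L) (c : k)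
    (a : UniversalEnvelopingAlgebra R L) : D x (c • a) = c • D x a := by
  rw [← algebraMap_smul R c a, (hD x).smul, Derivation.map_algebraMap, zero_smul, add_zero,
    algebraMap_smul]

/-- Composition with the derivations, as a flat connection on `End_k(U_R(L))`. -/
noncomputable def compDerivation
    (hD : ∀ x, IsLeibnizExtension (ιLinear R L) (P.anchor x) (P.triHom x) (D x)) :
    L →ₗ[R] (UniversalEnvelopingAlgebra R L →ₗ[k] UniversalEnvelopingAlgebra R L) →+
      (UniversalEnvelopingAlgebra R L →ₗ[k] UniversalEnvelopingAlgebra R L) where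
  toFun x := AddMonoidHom.mk' (fun e =>
      { toFun := fun X => D x (e X)
        map_add' := fun X Y => by simp only [map_add]
        map_smul' := fun c X => by
          rw [map_smul, P.derivation_smul_base hD, RingHom.id_apply] })
    (fun e e' => by ext X; exact map_add (D x) (e X) (e' X))
  map_add' x y := by
    ext e X
    exact congrArg (fun D' : _ →+ _ => D' (e X)) (map_add D x y)
  map_smul' f x := by
    ext e X
    exact congrArg (fun D' : _ →+ _ => D' (e X)) (map_smul D f x)

theorem compDerivation_apply
    (hD : ∀ x, IsLeibnizExtension (ιLinear R L) (P.anchor x) (P.triHom x) (D x)) (x : L)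
    (e : UniversalEnvelopingAlgebra R L →ₗ[k] UniversalEnvelopingAlgebra R L)
    (X : UniversalEnvelopingAlgebra R L) : P.compDerivation hD x e X = D x (e X) := rfl

/-- The crossed recursion with values in `End_k(U_R(L))`, connection `e ↦ D_x ∘ e` and initial value
the identity. Endomorphisms over `k` are needed since `D_x` is not `R`-linear in general. -/
theorem exists_recursive_product
    (hD : ∀ x, IsLeibnizExtension (ιLinear R L) (P.anchor x) (P.triHom x) (D x)) :
    ∃ T : UniversalEnvelopingAlgebra R L →ₗ[k]
        UniversalEnvelopingAlgebra R L →ₗ[k] UniversalEnvelopingAlgebra R L,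
      (∀ (f : R) X Y, T (f • X) Y = f • T X Y) ∧ (∀ Y, T 1 Y = Y) ∧
      ∀ x X Y, T (ι R x * X) Y = D x (T X Y) - T (D x X) Y := by
  obtain ⟨T, h0, h1⟩ := P.exists_crossed_recursion hD (nabla := P.compDerivation hD)
    (fun x f e => by
      ext X
      simp [compDerivation_apply, (hD x).smul])
    (fun x y e => by
      ext X
      simp [compDerivation_apply, P.isLeibnizExtension_subLie adjoin_range_ιLinear hD])
    LinearMap.id
  refine ⟨T.restrictScalars k, fun f X Y => ?_, fun Y => ?_, fun x X Y => ?_⟩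
  · simp
  · have := h0 1
    rw [map_one, one_smul] at this
    simp [this]
  · rw [LinearMap.restrictScalars_apply, LinearMap.restrictScalars_apply,
      LinearMap.restrictScalars_apply, h1]
    rfl

end PostLieRinehartAlgebra

/-! ### Uniqueness and the weak post-Hopf identities -/

namespace PostLieRinehartAlgebra

variable {k R L : Type*} [CommRing k] [CommRing R] [Algebra k R] [LieRing L] [LieAlgebra R L]
  [Module k L] [IsScalarTower k R L] {P : PostLieRinehartAlgebra k R L}

theorem ι_mul_induction {p : UniversalEnvelopingAlgebra R L → Prop}
    (base : ∀ f : R, p (algebraMap R _ f)) (add : ∀ a b, p a → p b → p (a + b))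
    (mul : ∀ (x : L) b, p b → p (ι R x * b)) (a : UniversalEnvelopingAlgebra R L) : p a :=
  LinearMap.induction_left_of_adjoin adjoin_range_ιLinear base add mul a

/-- `T` is the product on `U_R(L)` built by left recursion from the family `D` of Leibniz maps. -/
structure IsRecursiveProduct (P : PostLieRinehartAlgebra k R L)
    (D : L →ₗ[R] UniversalEnvelopingAlgebra R L →+ UniversalEnvelopingAlgebra R L)
    (T : UniversalEnvelopingAlgebra R L →ₗ[k]
      UniversalEnvelopingAlgebra R L →ₗ[k] UniversalEnvelopingAlgebra R L) : Prop where
  leibniz : ∀ x, IsLeibnizExtension (ιLinear R L) (P.anchor x) (P.triHom x) (D x)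
  smul : ∀ (f : R) X Y, T (f • X) Y = f • T X Y
  one : ∀ Y, T 1 Y = Y
  ι_mul : ∀ x X Y, T (ι R x * X) Y = D x (T X Y) - T (D x X) Y

namespace IsRecursiveProduct

variable {D : L →ₗ[R] UniversalEnvelopingAlgebra R L →+ UniversalEnvelopingAlgebra R L}
  {T : UniversalEnvelopingAlgebra R L →ₗ[k]
    UniversalEnvelopingAlgebra R L →ₗ[k] UniversalEnvelopingAlgebra R L}
  (h : IsRecursiveProduct P D T)

include h

theorem algebraMap_tri (f : R) (X : UniversalEnvelopingAlgebra R L) :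
    T (algebraMap R _ f) X = f • X := by
  rw [Algebra.algebraMap_eq_smul_one, h.smul, h.one]

theorem ι_tri (x : L) (X : UniversalEnvelopingAlgebra R L) : T (ι R x) X = D x X := by
  rw [← mul_one (ι R x), h.ι_mul, (h.leibniz x).map_one, map_zero, h.one]
  simp

theorem isExtension : P.IsExtension T where
  base_tri f X := by rw [h.algebraMap_tri, Algebra.smul_def]
  tri_base x f := by rw [h.ι_tri, (h.leibniz x).base]
  tri_mul x y X := by
    rw [h.ι_tri, h.ι_tri, (h.leibniz x).mul, ← ιLinear_apply y, (h.leibniz x).gen]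
    rfl
  mul_tri x X Y := by rw [h.ι_mul, h.ι_tri, h.ι_tri]

/-- The rules for `x ▷ f` and `x ▷ (y X)` force `x ▷ -` to be `D_x`; the rule for `(x X) ▷ Y` is
then the crossed recursion. -/
theorem eq_of_isExtension
    {T' : UniversalEnvelopingAlgebra R L →ₗ[k]
      UniversalEnvelopingAlgebra R L →ₗ[k] UniversalEnvelopingAlgebra R L}
    (h' : P.IsExtension T') : T' = T := by
  have hι : ∀ x X, T' (ι R x) X = D x X := by
    intro x X
    induction X using ι_mul_induction with
    | base f => rw [h'.tri_base, (h.leibniz x).base]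
    | add a b ha hb => rw [map_add, map_add, ha, hb]
    | mul y b hb =>
      rw [h'.tri_mul, hb, (h.leibniz x).mul, ← ιLinear_apply y, (h.leibniz x).gen]
      rfl
  have key : T'.toAddMonoidHom = T.toAddMonoidHom := by
    refine eq_of_crossed_recursion adjoin_range_ιLinear h.leibniz
      (fun x (e : UniversalEnvelopingAlgebra R L →ₗ[k] UniversalEnvelopingAlgebra R L) =>
        P.compDerivation h.leibniz x e) (fun f => ?_) (fun x b => ?_) (fun x b => ?_)
    · ext X
      exact (h'.base_tri f X).trans (h.isExtension.base_tri f X).symm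
    · ext X
      refine (h'.mul_tri x b X).trans ?_
      rw [hι, hι]
      rfl
    · ext X
      exact h.ι_mul x b X
  ext X Y
  exact congrArg (fun G : _ →+ (_ →ₗ[k] _) => G X Y) key

theorem extends_tri (x y : L) : T (ι R x) (ι R y) = ι R (P.tri x y) := by
  rw [h.ι_tri]
  exact (h.leibniz x).gen y

/-- Two additive maps with the same crossed recursion, the second one through the coproduct. -/
theorem eq_comp_comul {N : Type*} [AddCommGroup N] [Module R N] (nabla : L → N →+ N)
    {G : UniversalEnvelopingAlgebra R L → N} (G_add : ∀ X Y, G (X + Y) = G X + G Y)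
    {Φ : UniversalEnvelopingAlgebra R L →ₗ[R] UniversalEnvelopingAlgebra R L →ₗ[R] N}
    (h0 : ∀ f : R, G (algebraMap R _ f) = f • Φ 1 1)
    (hG : ∀ x X, G (ι R x * X) = nabla x (G X) - G (D x X))
    (hΦ : ∀ x a b, Φ (ι R x * a) b + Φ a (ι R x * b) =
      nabla x (Φ a b) - (Φ (D x a) b + Φ a (D x b)))
    (X : UniversalEnvelopingAlgebra R L) (p : Coalgebra.Repr R X ℕ) :
    G X = ∑ i ∈ p.index, Φ (p.left i) (p.right i) := by
  let Ψ := TensorProduct.lift Φ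
  -- As `Δ x = x ⊗ 1 + 1 ⊗ x`, the hypothesis `hΦ` is a crossed recursion for `D_x ⊗ 1 + 1 ⊗ D_x`;
  -- the coderivation property pulls it back along `Δ`.
  have hΨ : ∀ x t, Ψ (Coalgebra.comul (R := R) (ι R x) * t) =
      nabla x (Ψ t) - Ψ ((h.leibniz x).tensor t) := by
    intro x t
    induction t using TensorProduct.induction_on with
    | zero => simp
    | add s t hs ht => simp only [mul_add, map_add, hs, ht]; abel
    | tmul a b =>
      rw [comul_ι, add_mul, Algebra.TensorProduct.tmul_mul_tmul,
        Algebra.TensorProduct.tmul_mul_tmul, one_mul, one_mul, map_add,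
        IsLeibnizExtension.tensor_tmul, map_add]
      exact hΦ x a b
  have key : AddMonoidHom.mk' G G_add =
      (Ψ ∘ₗ Coalgebra.comul (R := R)).toAddMonoidHom := by
    refine eq_of_crossed_recursion adjoin_range_ιLinear h.leibniz (fun x => nabla x)
      (fun f => ?_) hG (fun x b => ?_)
    · change G _ = Ψ (Coalgebra.comul (R := R) (algebraMap R _ f))
      rw [h0, Bialgebra.comul_algebraMap, Algebra.algebraMap_eq_smul_one, map_smul]
      rfl
    · change Ψ (Coalgebra.comul (R := R) (ι R x * b)) = nabla x (Ψ (Coalgebra.comul (R := R) b)) -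
        Ψ (Coalgebra.comul (R := R) (D x b))
      rw [Bialgebra.comul_mul, hΨ, (h.leibniz x).comul]
  refine (DFunLike.congr_fun key X).trans ?_
  change Ψ (CoalgebraStruct.comul X) = _
  rw [← p.eq, map_sum]
  rfl

theorem tri_mul (X Y Z : UniversalEnvelopingAlgebra R L) (p : Coalgebra.Repr R X ℕ) :
    T X (Y * Z) = ∑ i ∈ p.index, T (p.left i) Y * T (p.right i) Z :=
  h.eq_comp_comul (fun x => D x) (G := fun X => T X (Y * Z)) (fun X X' => by simp)
    (Φ := LinearMap.mk₂ R (fun a b => T a Y * T b Z) (fun a a' b => by simp [add_mul])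
      (fun f a b => by simp [h.smul]) (fun a b b' => by simp [mul_add])
      (fun f a b => by simp [h.smul]))
    (fun f => by simp [h.algebraMap_tri, h.one])
    (fun x X => h.ι_mul x X _)
    (fun x a b => by
      simp only [LinearMap.mk₂_apply, h.ι_mul, (h.leibniz x).mul, sub_mul, mul_sub]
      abel) X p

/-- In the recursion for `(a (b ▷ Y)) ▷ Z`, the term with `a D_x(b ▷ Y)` produced by the left factor
cancels the one produced by expanding `(x b) ▷ Y`. -/
theorem tri_tri (X Y Z : UniversalEnvelopingAlgebra R L) (p : Coalgebra.Repr R X ℕ) :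
    T X (T Y Z) = ∑ i ∈ p.index, T (p.left i * T (p.right i) Y) Z :=
  h.eq_comp_comul (fun x => D x) (G := fun X => T X (T Y Z)) (fun X X' => by simp)
    (Φ := LinearMap.mk₂ R (fun a b => T (a * T b Y) Z) (fun a a' b => by simp [add_mul])
      (fun f a b => by simp [h.smul]) (fun a b b' => by simp [mul_add])
      (fun f a b => by simp [h.smul]))
    (fun f => by simp [h.algebraMap_tri, h.one])
    (fun x X => h.ι_mul x X _)
    (fun x a b => by
      simp only [LinearMap.mk₂_apply, h.ι_mul, (h.leibniz x).mul, mul_sub, mul_assoc, map_sub,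
        map_add, LinearMap.sub_apply, LinearMap.add_apply]
      abel) X p

/-- Here the recursion takes values in `U_R(L) ⊗ U_R(L)` with connection `D_x ⊗ 1 + 1 ⊗ D_x`, which
`D_x` matches under `Δ`. -/
theorem comul_tri (X Y : UniversalEnvelopingAlgebra R L) (p : Coalgebra.Repr R X ℕ)
    (q : Coalgebra.Repr R Y ℕ) :
    Coalgebra.comul (R := R) (T X Y) = ∑ i ∈ p.index, ∑ j ∈ q.index,
      T (p.left i) (q.left j) ⊗ₜ[R] T (p.right i) (q.right j) :=
  h.eq_comp_comul (fun x => (h.leibniz x).tensor)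
    (G := fun X => Coalgebra.comul (R := R) (T X Y)) (fun X X' => by simp)
    (Φ := LinearMap.mk₂ R
      (fun a b => ∑ j ∈ q.index, T a (q.left j) ⊗ₜ[R] T b (q.right j))
      (fun a a' b => by simp [TensorProduct.add_tmul, Finset.sum_add_distrib])
      (fun f a b => by simp [h.smul, TensorProduct.smul_tmul', Finset.smul_sum])
      (fun a b b' => by simp [TensorProduct.tmul_add, Finset.sum_add_distrib])
      (fun f a b => by simp [h.smul, Finset.smul_sum]))
    (fun f => by
      simp only [h.algebraMap_tri, h.one, LinearMap.mk₂_apply, map_smul]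
      rw [q.eq])
    (fun x X => by simp only [h.ι_mul, map_sub, (h.leibniz x).comul])
    (fun x a b => by
      simp only [LinearMap.mk₂_apply, map_sum, ← Finset.sum_add_distrib, ← Finset.sum_sub_distrib]
      refine Finset.sum_congr rfl fun j _ => ?_
      simp only [h.ι_mul, IsLeibnizExtension.tensor_tmul, TensorProduct.sub_tmul,
        TensorProduct.tmul_sub]
      abel) X p

theorem counit_tri (X Y : UniversalEnvelopingAlgebra R L) :
    algebraMap R (UniversalEnvelopingAlgebra R L) (Coalgebra.counit (T X Y)) =
      T X (algebraMap R _ (Coalgebra.counit Y)) := by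
  have key : AddMonoidHom.mk' (fun X => algebraMap R (UniversalEnvelopingAlgebra R L)
      (Coalgebra.counit (T X Y))) (fun X X' => by simp) =
      AddMonoidHom.mk' (fun X => T X (algebraMap R _ (Coalgebra.counit Y)))
        (fun X X' => by simp) := by
    refine eq_of_crossed_recursion adjoin_range_ιLinear h.leibniz (fun x => D x)
      (fun f => ?_) (fun x X => ?_) (fun x X => h.ι_mul x X _)
    · simp only [AddMonoidHom.mk'_apply, h.algebraMap_tri, Algebra.smul_def,
        Bialgebra.counit_mul, Bialgebra.counit_algebraMap, map_mul]
    · simp only [AddMonoidHom.mk'_apply, ιLinear_apply, h.ι_mul, map_sub, (h.leibniz x).base,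
        (h.leibniz x).counit (map_zero _) (map_add _)]
  exact DFunLike.congr_fun key X

theorem tri_one (X : UniversalEnvelopingAlgebra R L) :
    T X 1 = algebraMap R _ (Coalgebra.counit X) := by
  have key : AddMonoidHom.mk' (fun X => T X 1) (fun X X' => by simp) =
      AddMonoidHom.mk' (fun X => algebraMap R (UniversalEnvelopingAlgebra R L)
        (Coalgebra.counit X)) (fun X X' => by simp) := by
    refine eq_of_crossed_recursion adjoin_range_ιLinear h.leibniz (fun x => D x)
      (fun f => ?_) (fun x X => h.ι_mul x X _) (fun x X => ?_)
    · rw [AddMonoidHom.mk'_apply, AddMonoidHom.mk'_apply, h.algebraMap_tri,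
        Bialgebra.counit_algebraMap, Algebra.algebraMap_eq_smul_one]
    -- Both sides vanish: the counit kills `x X`, and it intertwines `D_x` with the anchor.
    · simp only [AddMonoidHom.mk'_apply, ιLinear_apply, Bialgebra.counit_mul, counit_ι, zero_mul, map_zero,
        (h.leibniz x).base, (h.leibniz x).counit (map_zero _) (map_add _), sub_self]
  exact DFunLike.congr_fun key X

theorem isWeakPostHopfAlgebroid :
    IsWeakPostHopfAlgebroid k R (UniversalEnvelopingAlgebra R L) T where
  toIsCocommHopfRAlgebra := isCocommHopfRAlgebra R L
  comul_tri := h.comul_tri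
  tri_one := h.tri_one
  one_tri := h.one
  counit_tri := h.counit_tri
  smul_tri := h.smul
  tri_mul := h.tri_mul
  tri_tri := h.tri_tri

end IsRecursiveProduct

end PostLieRinehartAlgebra

theorem mainTheorem1 (k R L : Type*) [Field k] [CommRing R] [Algebra k R]
    [LieRing L] [LieAlgebra R L] [Module k L] [IsScalarTower k R L]
    (P : PostLieRinehartAlgebra k R L) :
    ∃ T : UniversalEnvelopingAlgebra R L →ₗ[k]
        UniversalEnvelopingAlgebra R L →ₗ[k] UniversalEnvelopingAlgebra R L,
      P.IsExtension T ∧ (∀ T', P.IsExtension T' → T' = T) ∧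
      (∀ x y : L, T (UniversalEnvelopingAlgebra.ι R x) (UniversalEnvelopingAlgebra.ι R y) =
        UniversalEnvelopingAlgebra.ι R (P.tri x y)) ∧
      IsWeakPostHopfAlgebroid k R (UniversalEnvelopingAlgebra R L) T := by
  obtain ⟨D, hD⟩ := P.exists_derivations
  obtain ⟨T, h_smul, h_one, h_rec⟩ := P.exists_recursive_product hD
  have h : P.IsRecursiveProduct D T := ⟨hD, h_smul, h_one, h_rec⟩
  exact ⟨T, h.isExtension, fun _ h' => h.eq_of_isExtension h', h.extends_tri,
    h.isWeakPostHopfAlgebroid⟩
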